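/- Let $(X_k)_{k\ge 1}$ and $(Y_k)_{k\ge 1}$ be two independent, real-valued, stationary Gaussian processes with $\mathrm{E}X_1=\mathrm{E}Y_1=0$ and $\mathrm{Var}(X_1)=\mathrm{Var}(Y_1)=1$. Let $D\in(0,\tfrac12)$, let $C\in\mathbb{R}$ be a constant, let $L$ be a slowly varying function (measurable, eventually positive, with $L(ax)/L(x)\to 1$ as $x\to\infty$ for every $a>0$), and assume that for all integers $k\ge 1$ $$\rho_X(k)=\mathrm{Cov}(X_1,X_{1+k})=k^{-D}L(k),\qquad \rho_Y(k)=\mathrm{Cov}(Y_1,Y_{1+k})=C\,k^{-D}L(k)$$ (so $X$, and for $C>0$ also $Y$, is long-range dependent with parameter $D$). Write $\varphi_X(s)=\mathrm{E}\,e^{isX_1}$ and $\varphi_Y(t)=\mathrm{E}\,e^{itY_1}$. For a constant $c>0$ let $\omega(s,t)=(c^2s^2t^2)^{-1}$ and let $\|f\|_2=\bigl(\int_{\mathbb{R}}\int_{\mathbb{R}}|f(s,t)|^2\,\omega(s,t)\,ds\,dt\bigr)^{1/2}$ be the norm of $L^2(\mathbb{R}^2,\omega(s,t)\,ds\,dt)$.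 Then, for every $n$, the function of $(s,t)$ $$\frac1n\sum_{j=1}^n\bigl(e^{isX_j}-\varphi_X(s)\bigr)\bigl(e^{itY_j}-\varphi_Y(t)\bigr)+s\,e^{-s^2/2}\,t\,e^{-t^2/2}\,\frac1n\sum_{j=1}^nX_jY_j$$ belongs to $L^2(\mathbb{R}^2,\omega(s,t)\,ds\,dt)$ for every realisation, and, as $n\to\infty$, $$\Bigl\|\frac1n\sum_{j=1}^n\bigl(e^{isX_j}-\varphi_X(s)\bigr)\bigl(e^{itY_j}-\varphi_Y(t)\bigr)+s\,e^{-s^2/2}\,t\,e^{-t^2/2}\,\frac1n\sum_{j=1}^nX_jY_j\Bigr\|_2=o_P\bigl(n^{-D}L(n)\bigr),$$ i.e. the left-hand side divided by $n^{-D}L(n)$ converges to $0$ in probability. -/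

import Mathlib

open MeasureTheory ProbabilityTheory Filter Topology

/-- A (Karamata) slowly varying function: measurable, eventually positive, and
`L (a x) / L x → 1` as `x → ∞` for every `a > 0`. -/
structure IsSlowlyVarying (L : ℝ → ℝ) : Prop where
  measurable : Measurable L
  eventually_pos : ∀ᶠ x in atTop, 0 < L x
  tendsto_ratio : ∀ a : ℝ, 0 < a → Tendsto (fun x => L (a * x) / L x) atTop (𝓝 1)

/-- (Second-order) stationarity of a real-valued time series. For Gaussian processes this is
the same as strict stationarity. -/
structure IsStationarySeq {Ω : Type*} [MeasurableSpace Ω] (X : ℕ → Ω → ℝ) (P : Measure Ω) :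
    Prop where
  memLp_two : ∀ k, MemLp (X k) 2 P
  mean_eq : ∀ k, P[X k] = P[X 0]
  cov_eq : ∀ j k, cov[X j, X (j + k); P] = cov[X 0, X k; P]

/-- A stationary Gaussian process of real random variables, with zero mean and unit variance.
The time series `X₁, X₂, …` is indexed from zero: `X j` stands for `X_{j+1}`. -/
structure IsStandardStationaryGaussian {Ω : Type*} [MeasurableSpace Ω] (X : ℕ → Ω → ℝ)
    (P : Measure Ω) : Prop where
  measurable : ∀ k, Measurable (X k)
  gaussian : IsGaussianProcess X P
  stationary : IsStationarySeq X P
  mean_zero : P[X 0] = 0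
  var_one : Var[X 0; P] = 1

/-- The auto-covariance function `ρ(k) = Cov(X₁, X_{1+k})`. -/
noncomputable def autocov {Ω : Type*} [MeasurableSpace Ω] (X : ℕ → Ω → ℝ) (P : Measure Ω)
    (k : ℕ) : ℝ :=
  cov[X 0, X k; P]

/-- The measure `ω(s, t) ds dt` on `ℝ²` with the weight `ω(s, t) = (c² s² t²)⁻¹` of the distance
covariance. -/
noncomputable def dcovMeasure (c : ℝ) : Measure (ℝ × ℝ) :=
  volume.withDensity fun p => ENNReal.ofReal ((c ^ 2 * p.1 ^ 2 * p.2 ^ 2)⁻¹)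

/-- The characteristic function `φ_X(s) = E exp(i s X₁)` of the marginal distribution. -/
noncomputable def marginalCharFun {Ω : Type*} [MeasurableSpace Ω] (X : ℕ → Ω → ℝ)
    (P : Measure Ω) (s : ℝ) : ℂ :=
  ∫ ω, Complex.exp (Complex.I * s * X 0 ω) ∂P

/-- For a realisation `ω`, the function of `(s, t)` given by
`(1/n) ∑_{j=1}^n (exp(i s X_j) - φ_X(s)) (exp(i t Y_j) - φ_Y(t))
  + exp(-s²/2) s exp(-t²/2) t (1/n) ∑_{j=1}^n X_j Y_j`. -/
noncomputable def reductionError {Ω : Type*} [MeasurableSpace Ω] (X Y : ℕ → Ω → ℝ)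
    (P : Measure Ω) (n : ℕ) (ω : Ω) (p : ℝ × ℝ) : ℂ :=
  (1 / (n : ℂ)) * ∑ j ∈ Finset.range n,
      (Complex.exp (Complex.I * p.1 * X j ω) - marginalCharFun X P p.1) *
        (Complex.exp (Complex.I * p.2 * Y j ω) - marginalCharFun Y P p.2)
    + ((Real.exp (-p.1 ^ 2 / 2) * p.1 * (Real.exp (-p.2 ^ 2 / 2) * p.2) *
        ((1 / (n : ℝ)) * ∑ j ∈ Finset.range n, X j ω * Y j ω) : ℝ) : ℂ)

/-- `Z n = o_P(a n)` for real random variables `Z n` and a (for large `n` nonzero) deterministic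
sequence `a`: the quotients `Z n / a n` converge to `0` in probability. -/
def IsLittleOInProbability {Ω : Type*} [MeasurableSpace Ω] (P : Measure Ω) (Z : ℕ → Ω → ℝ)
    (a : ℕ → ℝ) : Prop :=
  TendstoInMeasure P (fun n ω => Z n ω / a n) atTop (fun _ => 0)

/-!
Subtracting the leading term of the Hermite expansion leaves a remainder small enough for its mean
square to be computed exactly and bounded.

For a standard Gaussian pair `(U, V)` with covariance `r`, the variable `exp(isU) - exp(-s²/2)` has
the linear Hermite component `i s exp(-s²/2) U`, and its covariance kernel is
`exp(-s²) (exp(s² r) - 1)`. The product of the linear components of the two factors in the summand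
is `-s exp(-s²/2) t exp(-t²/2) X_j Y_j`, which is what `reductionError` removes. By independence of
`X` and `Y`, the covariance of the `j`-th and `k`-th remainders at `(s, t)` is
`exp(-s²-t²) ((exp(s² a) - 1) (exp(t² b) - 1) - s² a t² b)`, where `a = ρ_X(|j-k|)` and
`b = ρ_Y(|j-k|)` (`integrable_hermiteRemainder_mul_conj_and_integral_eq`). Since `|a|, |b| ≤ 1`,
comparing power series bounds it by
`4 (a² |b| + |a| b²) · s²/(1+s²) · t²/(1+t²)` (`abs_remainderCov_le`), and the functions of `s` and
`t` have finite integral against the weight `(c² s² t²)⁻¹`. As `ρ_Y = C ρ_X` at positive lags,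
Tonelli's theorem shows that the mean of the squared norm is at most a constant times
`(1/n) ∑_{k<n} |ρ_X(k)|³` (`lintegral_lpNorm_reductionError_sq_le`).

It remains to compare this mean of cubes with `ρ_X(n)² = n^(-2D) L(n)²`. The uniform convergence
theorem for measurable slowly varying functions gives `K⁻¹ n^(-δ) ≤ L(n) ≤ K n^δ` eventually, for
every `δ > 0` (`IsSlowlyVarying.exists_rpow_bounds`). Because the covariance is cubed and `2D < 1`,
a small `δ` makes the quotient of order `n^(-δ)`
(`IsSlowlyVarying.tendsto_mean_abs_cube_div_sq`). Convergence in `L²(P)` then implies convergence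
in probability.
-/

/-! ### Slowly varying functions -/

/-- Uniform convergence theorem for measurable slowly varying functions, in additive form: the
oscillation of `x ↦ log L(eˣ)` over unit intervals tends to zero. The set of `t ∈ [0, 2]` for which
the increment from `x` to `x + t` is not small has measure tending to `0`; hence for large `x` and
`u ∈ [0, 1]` some point `x + t` is good both for `x` and for `x + u`. -/
lemma IsSlowlyVarying.abs_log_comp_exp_sub_le {L : ℝ → ℝ} (hL : IsSlowlyVarying L) {ε : ℝ}
    (hε : 0 < ε) :
    ∃ x₀ : ℝ, ∀ x ≥ x₀, ∀ u ∈ Set.Icc (0 : ℝ) 1,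
      |Real.log (L (Real.exp (x + u))) - Real.log (L (Real.exp x))| ≤ ε := by
  set h : ℝ → ℝ := fun x => Real.log (L (Real.exp x)) with hh
  have hmeas : Measurable h := Real.measurable_log.comp (hL.measurable.comp Real.measurable_exp)
  have hlim : ∀ t : ℝ, Tendsto (fun x => h (x + t) - h x) atTop (𝓝 0) := by
    intro t
    have h1 := (hL.tendsto_ratio (Real.exp t) (Real.exp_pos t)).comp Real.tendsto_exp_atTop
    have h2 := (Real.continuousAt_log one_ne_zero).tendsto.comp h1
    rw [Real.log_one] at h2
    refine h2.congr' ?_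
    have hp := Real.tendsto_exp_atTop.eventually hL.eventually_pos
    filter_upwards [hp, (tendsto_atTop_add_const_right atTop t tendsto_id).eventually hp]
      with x hx hxt
    simp only [Function.comp, hh, id] at *
    rw [← Real.exp_add, add_comm t x, Real.log_div hxt.ne' hx.ne']
  let bad : ℝ → Set ℝ := fun x => {t | ε / 2 ≤ |h (x + t) - h x|}
  let μ : Measure ℝ := volume.restrict (Set.Icc 0 2)
  have hbad : ∀ x, MeasurableSet (bad x) := fun x =>
    measurableSet_le measurable_const
      (((hmeas.comp (measurable_const_add x)).sub_const _).abs)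
  have hμ : Tendsto (fun x => μ (bad x)) atTop (𝓝 (μ ∅)) := by
    refine tendsto_measure_of_ae_tendsto_indicator_of_isFiniteMeasure (L := atTop)
      MeasurableSet.empty hbad (Eventually.of_forall fun t => ?_)
    have := (hlim t).abs.eventually_lt_const (u := ε / 2) (by simpa using hε)
    filter_upwards [this] with x hx
    simp only [bad, Set.mem_ofPred_eq, Set.mem_empty_iff_false, iff_false, not_le]
    exact hx
  rw [measure_empty] at hμ
  obtain ⟨x₀, hx₀⟩ := eventually_atTop.1 (hμ.eventually_lt_const (u := 1 / 2) (by simp))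
  refine ⟨x₀, fun x hx u hu => ?_⟩
  have b1 := hx₀ x hx
  have b2 := hx₀ (x + u) (by linarith [hu.1])
  have hex : ∃ t ∈ Set.Icc u 2, t ∉ bad x ∧ t - u ∉ bad (x + u) := by
    by_contra! hcon
    have hsub : Set.Icc u 2 ⊆ (bad x ∩ Set.Icc 0 2) ∪
        (fun t => t + -u) ⁻¹' (bad (x + u) ∩ Set.Icc 0 2) := by
      intro t ht
      by_cases h1 : t ∈ bad x
      · exact Or.inl ⟨h1, hu.1.trans ht.1, ht.2⟩
      · refine Or.inr ⟨?_, ?_, ?_⟩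
        · simpa [sub_eq_add_neg] using hcon t ht h1
        · linarith [ht.1]
        · linarith [ht.2, hu.1]
    have h3 := (measure_mono hsub).trans (measure_union_le (μ := volume) _ _)
    rw [measure_preimage_add_right, Real.volume_Icc] at h3
    rw [Measure.restrict_apply (hbad _)] at b1 b2
    have h4 := h3.trans_lt (ENNReal.add_lt_add b1 b2)
    rw [one_div, ENNReal.inv_two_add_inv_two, ENNReal.ofReal_lt_one] at h4
    linarith [hu.2]
  obtain ⟨t, -, ht1, ht2⟩ := hex
  simp only [bad, Set.mem_ofPred_eq, not_le] at ht1 ht2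
  rw [show x + u + (t - u) = x + t by ring] at ht2
  rw [abs_lt] at ht1 ht2
  rw [abs_le]
  constructor <;> simp only [hh] at * <;> linarith [ht1.1, ht1.2, ht2.1, ht2.2]

/-- A slowly varying function lies eventually between `K⁻¹ n^(-δ)` and `K n^δ`, for every `δ > 0`
(a weak form of Potter's bounds). -/
lemma IsSlowlyVarying.exists_rpow_bounds {L : ℝ → ℝ} (hL : IsSlowlyVarying L) {δ : ℝ}
    (hδ : 0 < δ) :
    ∃ K : ℝ, 0 < K ∧ ∀ᶠ n : ℕ in atTop,
      K⁻¹ * (n : ℝ) ^ (-δ) ≤ L n ∧ L n ≤ K * (n : ℝ) ^ δ := by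
  obtain ⟨x₀', hx₀'⟩ := hL.abs_log_comp_exp_sub_le hδ
  obtain ⟨x₀, hx₀1, hx₀0⟩ : ∃ x₀ : ℝ, x₀' ≤ x₀ ∧ 0 ≤ x₀ :=
    ⟨max x₀' 0, le_max_left _ _, le_max_right _ _⟩
  set h : ℝ → ℝ := fun x => Real.log (L (Real.exp x)) with hh
  have hosc : ∀ x ≥ x₀, ∀ u ∈ Set.Icc (0 : ℝ) 1, |h (x + u) - h x| ≤ δ :=
    fun x hx => hx₀' x (hx₀1.trans hx)
  have hstep : ∀ m : ℕ, |h (x₀ + m) - h x₀| ≤ m * δ := by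
    intro m
    induction m with
    | zero => simp
    | succ m ih =>
      have h1 := hosc (x₀ + m) (by simp) 1 (by simp)
      have h2 := abs_sub_le (h (x₀ + m + 1)) (h (x₀ + m)) (h x₀)
      push_cast
      rw [← add_assoc]
      linarith
  have hall : ∀ x ≥ x₀, |h x - h x₀| ≤ δ * x + δ := by
    intro x hx
    have h0 : 0 ≤ x - x₀ := by linarith
    have hf := Nat.floor_le h0
    have h1 := hosc (x₀ + ⌊x - x₀⌋₊) (by simp) (x - x₀ - ⌊x - x₀⌋₊)
      ⟨by linarith, by linarith [Nat.lt_floor_add_one (x - x₀)]⟩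
    rw [show x₀ + (⌊x - x₀⌋₊ : ℝ) + (x - x₀ - ⌊x - x₀⌋₊) = x by ring] at h1
    have h2 := abs_sub_le (h x) (h (x₀ + ⌊x - x₀⌋₊)) (h x₀)
    have h3 := hstep ⌊x - x₀⌋₊
    nlinarith
  refine ⟨Real.exp (|h x₀| + δ), Real.exp_pos _, ?_⟩
  filter_upwards [tendsto_natCast_atTop_atTop.eventually hL.eventually_pos,
    tendsto_natCast_atTop_atTop.eventually (eventually_ge_atTop (Real.exp x₀))] with n hn hn2
  have hn0 : (0 : ℝ) < n := (Real.exp_pos _).trans_le hn2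
  have key := hall (Real.log n) ((Real.le_log_iff_exp_le hn0).2 hn2)
  rw [show h (Real.log n) = Real.log (L n) by simp only [hh]; rw [Real.exp_log hn0], abs_le] at key
  rw [← Real.exp_neg, Real.rpow_def_of_pos hn0, Real.rpow_def_of_pos hn0, ← Real.exp_add,
    ← Real.exp_add, ← Real.le_log_iff_exp_le hn, ← Real.log_le_iff_le_exp hn]
  constructor
  · linarith [key.1, neg_abs_le (h x₀)]
  · linarith [key.2, le_abs_self (h x₀)]

/-! ### Averages of cubed covariances -/

lemma sum_range_rpow_neg_le {q : ℝ} (hq0 : 0 ≤ q) (hq : q < 1) (n : ℕ) :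
    ∑ k ∈ Finset.range n, ((k : ℝ) + 1) ^ (-q) ≤ (n : ℝ) ^ (1 - q) / (1 - q) := by
  have hq' : 0 < 1 - q := by linarith
  induction n with
  | zero => simp [Real.zero_rpow hq'.ne']
  | succ n ih =>
    rw [Finset.sum_range_succ]
    refine (add_le_add_left ih _).trans ?_
    have hn : (0 : ℝ) < n + 1 := by positivity
    have hb := rpow_one_add_le_one_add_mul_self (s := -(1 / ((n : ℝ) + 1)))
      (by rw [neg_le_neg_iff, div_le_one hn]; linarith [Nat.cast_nonneg (α := ℝ) n])
      hq'.le (by linarith)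
    rw [show 1 + -(1 / ((n : ℝ) + 1)) = n / (n + 1) by field_simp; ring,
      Real.div_rpow (Nat.cast_nonneg n) hn.le, div_le_iff₀ (Real.rpow_pos_of_pos hn _)] at hb
    have e : ((n : ℝ) + 1) ^ (1 - q) = (n + 1) ^ (-q) * (n + 1) := by
      rw [← Real.rpow_add_one hn.ne']; ring_nf
    push_cast
    rw [div_add' _ _ _ hq'.ne']
    gcongr
    refine (add_le_add_left hb _).trans (le_of_eq ?_)
    rw [e]; field_simp; ring

/-- If `ρ(k) = k^(-D) L(k)` with `L` slowly varying and `D ∈ (0, 1/2)`, then the mean of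
`|ρ(0)|³, …, |ρ(n-1)|³` is negligible compared with `ρ(n)²`. -/
lemma IsSlowlyVarying.tendsto_mean_abs_cube_div_sq {L : ℝ → ℝ} (hL : IsSlowlyVarying L)
    {D : ℝ} (hD0 : 0 < D) (hD : D < 1 / 2) {ρ : ℕ → ℝ}
    (hρ : ∀ k : ℕ, 1 ≤ k → ρ k = (k : ℝ) ^ (-D) * L k) :
    Tendsto (fun n : ℕ => ((1 / (n : ℝ)) * ∑ k ∈ Finset.range n, |ρ k| ^ 3) /
      ((n : ℝ) ^ (-D) * L n) ^ 2) atTop (𝓝 0) := by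
  -- `δ` is small enough for `2 D + 3 δ ≤ 3 (D - δ)` and `2 D + 3 δ < 1`.
  obtain ⟨δ, hδ, hδ1, hδ2⟩ : ∃ δ : ℝ, 0 < δ ∧ 6 * δ ≤ D ∧ 3 * δ < 1 - 2 * D :=
    ⟨min (D / 6) ((1 - 2 * D) / 4), lt_min (by linarith) (by linarith),
      by linarith [min_le_left (D / 6) ((1 - 2 * D) / 4)],
      by linarith [min_le_right (D / 6) ((1 - 2 * D) / 4)]⟩
  set q : ℝ := 2 * D + 3 * δ with hq
  have hq0 : 0 ≤ q := by positivity
  have hq1 : q < 1 := by linarith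
  obtain ⟨K, hK, hev⟩ := hL.exists_rpow_bounds hδ
  obtain ⟨N, hN⟩ := eventually_atTop.1 hev
  -- The finitely many indices below `N` only affect the constant.
  obtain ⟨M, hM0, hM⟩ : ∃ M : ℝ, 0 ≤ M ∧ ∀ k : ℕ, |ρ k| ^ 3 ≤ M * ((k : ℝ) + 1) ^ (-q) := by
    refine ⟨∑ k ∈ Finset.range (N + 1), |ρ k| ^ 3 * ((k : ℝ) + 1) ^ q + 2 ^ q * K ^ 3, ?_,
      fun k => ?_⟩
    · positivity
    have hk1 : (0 : ℝ) < (k : ℝ) + 1 := by positivity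
    have hs : 0 ≤ ∑ k ∈ Finset.range (N + 1), |ρ k| ^ 3 * ((k : ℝ) + 1) ^ q :=
      Finset.sum_nonneg fun _ _ => by positivity
    rw [Real.rpow_neg hk1.le, ← div_eq_mul_inv, le_div_iff₀ (Real.rpow_pos_of_pos hk1 _)]
    rcases lt_or_ge k (N + 1) with hk | hk
    · have := Finset.single_le_sum (f := fun k : ℕ => |ρ k| ^ 3 * ((k : ℝ) + 1) ^ q)
        (fun _ _ => by positivity) (Finset.mem_range.2 hk)
      have h2 : 0 ≤ 2 ^ q * K ^ 3 := by positivity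
      linarith
    · have hk0 : (1 : ℝ) ≤ k := by exact_mod_cast (by omega : 1 ≤ k)
      have hkp : (0 : ℝ) < k := by linarith
      obtain ⟨hl, hu⟩ := hN k (by omega)
      have hLk : 0 ≤ L k := le_trans (by positivity) hl
      have h1 : |ρ k| ≤ K * (k : ℝ) ^ (δ - D) := by
        rw [hρ k (by omega), abs_of_nonneg (by positivity), show δ - D = -D + δ by ring,
          Real.rpow_add hkp]
        calc (k : ℝ) ^ (-D) * L k ≤ (k : ℝ) ^ (-D) * (K * (k : ℝ) ^ δ) := by gcongr
          _ = _ := by ring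
      have h3 : |ρ k| ^ 3 ≤ K ^ 3 * (k : ℝ) ^ (-q) := by
        calc |ρ k| ^ 3 ≤ (K * (k : ℝ) ^ (δ - D)) ^ 3 := by gcongr
          _ = K ^ 3 * (k : ℝ) ^ ((δ - D) * (3 : ℕ)) := by
            rw [mul_pow, Real.rpow_mul_natCast hkp.le]
          _ ≤ K ^ 3 * (k : ℝ) ^ (-q) := by
            gcongr
            push_cast; linarith
      have h4 : ((k : ℝ) + 1) ^ q ≤ 2 ^ q * (k : ℝ) ^ q := by
        rw [← Real.mul_rpow (by norm_num) hkp.le]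
        gcongr; linarith
      calc |ρ k| ^ 3 * ((k : ℝ) + 1) ^ q ≤ (K ^ 3 * (k : ℝ) ^ (-q)) * (2 ^ q * (k : ℝ) ^ q) := by
            gcongr
        _ = 2 ^ q * K ^ 3 * ((k : ℝ) ^ (-q) * (k : ℝ) ^ q) := by ring
        _ = 2 ^ q * K ^ 3 := by rw [← Real.rpow_add hkp]; simp
        _ ≤ _ := by linarith
  have hlim : Tendsto (fun n : ℕ => M / (1 - q) * K ^ 2 * (n : ℝ) ^ (-δ)) atTop (𝓝 0) := by
    simpa using ((tendsto_rpow_neg_atTop hδ).comp tendsto_natCast_atTop_atTop).const_mul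
      (M / (1 - q) * K ^ 2)
  refine squeeze_zero' (Eventually.of_forall fun n => by positivity) ?_ hlim
  filter_upwards [eventually_ge_atTop (N + 1)] with n hn
  have hn0 : (0 : ℝ) < n := by exact_mod_cast (by omega : 0 < n)
  obtain ⟨hl, -⟩ := hN n (by omega)
  have ha : K⁻¹ * (n : ℝ) ^ (-D - δ) ≤ (n : ℝ) ^ (-D) * L n := by
    rw [sub_eq_add_neg, Real.rpow_add hn0]
    calc K⁻¹ * ((n : ℝ) ^ (-D) * (n : ℝ) ^ (-δ))
        = (n : ℝ) ^ (-D) * (K⁻¹ * (n : ℝ) ^ (-δ)) := by ring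
      _ ≤ _ := by gcongr
  have ha0 : 0 < K⁻¹ * (n : ℝ) ^ (-D - δ) := by positivity
  rw [div_le_iff₀ (pow_pos (ha0.trans_le ha) 2)]
  have hS : ∑ k ∈ Finset.range n, |ρ k| ^ 3 ≤ M * ((n : ℝ) ^ (1 - q) / (1 - q)) := by
    refine (Finset.sum_le_sum fun k _ => hM k).trans ?_
    rw [← Finset.mul_sum]
    exact mul_le_mul_of_nonneg_left (sum_range_rpow_neg_le hq0 hq1 n) hM0
  have hq' : 0 < 1 - q := by linarith
  calc 1 / (n : ℝ) * ∑ k ∈ Finset.range n, |ρ k| ^ 3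
      ≤ 1 / (n : ℝ) * (M * ((n : ℝ) ^ (1 - q) / (1 - q))) := by gcongr
    _ = M / (1 - q) * ((n : ℝ) ^ (1 - q) / n) := by ring
    _ = M / (1 - q) * K ^ 2 * (n : ℝ) ^ (-δ) * (K⁻¹ * (n : ℝ) ^ (-D - δ)) ^ 2 := by
      rw [← Real.rpow_sub_one hn0.ne', mul_pow, ← Real.rpow_mul_natCast hn0.le,
        show 1 - q - 1 = -δ + (-D - δ) * (2 : ℕ) by push_cast; rw [hq]; ring, Real.rpow_add hn0]
      field_simp
    _ ≤ _ := by gcongr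

/-! ### Centred exponentials of Gaussian variables -/

/-- The function `x ↦ exp(i s x) - exp(-s²/2)`; for a standard Gaussian variable `U` the variable
`centeredExp s U` is `exp(i s U)` minus its mean. -/
noncomputable def centeredExp (s x : ℝ) : ℂ :=
  Complex.exp (Complex.I * s * x) - Real.exp (-s ^ 2 / 2)

@[fun_prop]
lemma measurable_centeredExp (s : ℝ) : Measurable (centeredExp s) := by
  unfold centeredExp; fun_prop

lemma norm_cexp_I_mul_mul (s x : ℝ) : ‖Complex.exp (Complex.I * s * x)‖ = 1 := by
  rw [show Complex.I * s * x = ((s * x : ℝ) : ℂ) * Complex.I by push_cast; ring,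
    Complex.norm_exp_ofReal_mul_I]

lemma norm_centeredExp_le_two (s x : ℝ) : ‖centeredExp s x‖ ≤ 2 := by
  refine (norm_sub_le _ _).trans ?_
  rw [norm_cexp_I_mul_mul, Complex.norm_real, Real.norm_of_nonneg (Real.exp_pos _).le]
  have : Real.exp (-s ^ 2 / 2) ≤ 1 := Real.exp_le_one_iff.2 (by nlinarith [sq_nonneg s])
  linarith

lemma conj_centeredExp (s x : ℝ) :
    (starRingEnd ℂ) (centeredExp s x) = centeredExp (-s) x := by
  simp only [centeredExp, map_sub, ← Complex.exp_conj, map_mul, Complex.conj_I, Complex.conj_ofReal]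
  push_cast
  ring_nf

section GaussianPair

variable {Ω : Type*} [MeasurableSpace Ω] {P : Measure Ω} {U V : Ω → ℝ}

lemma ProbabilityTheory.HasGaussianLaw.complexMGF_of_mean_zero (hU : HasGaussianLaw U P)
    (hU0 : P[U] = 0) (z : ℂ) : complexMGF U P z = Complex.exp (Var[U; P] * z ^ 2 / 2) := by
  rw [complexMGF_gaussianReal hU.map_eq_gaussianReal, hU0,
    Real.coe_toNNReal _ (variance_nonneg _ _)]
  simp

lemma ProbabilityTheory.HasGaussianLaw.integrableExpSet_eq_univ (hU : HasGaussianLaw U P) :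
    integrableExpSet U P = Set.univ := by
  have h := integrableExpSet_id_gaussianReal (μ := P[U]) (v := Var[U; P].toNNReal)
  rw [← hU.map_eq_gaussianReal] at h
  rw [← h]
  ext t
  simp only [integrableExpSet, Set.mem_ofPred_eq, id]
  exact (integrable_map_measure (f := U) (g := fun x => Real.exp (t * x)) (by fun_prop)
    hU.aemeasurable).symm

lemma ProbabilityTheory.HasGaussianLaw.integral_mul_cexp_self (hU : HasGaussianLaw U P)
    (hU0 : P[U] = 0) (hU1 : Var[U; P] = 1) (s : ℝ) :
    ∫ ω, (U ω : ℂ) * Complex.exp (Complex.I * s * U ω) ∂P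
      = Complex.I * s * Real.exp (-s ^ 2 / 2) := by
  have h1 : HasDerivAt (complexMGF U P) (∫ ω, (U ω : ℂ) * Complex.exp (Complex.I * s * U ω) ∂P)
      (Complex.I * s) := hasDerivAt_complexMGF (by simp [hU.integrableExpSet_eq_univ])
  have h2 : HasDerivAt (fun z : ℂ => Complex.exp (z ^ 2 / 2))
      (Complex.exp ((Complex.I * s) ^ 2 / 2) * (((2 : ℕ) : ℂ) * (Complex.I * s) ^ (2 - 1) / 2))
      (Complex.I * s) := ((hasDerivAt_pow 2 _).div_const 2).cexp
  have h3 : complexMGF U P = fun z : ℂ => Complex.exp (z ^ 2 / 2) := by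
    ext z; rw [hU.complexMGF_of_mean_zero hU0, hU1]; simp
  rw [h3] at h1
  rw [h1.unique h2]
  push_cast
  rw [mul_pow, Complex.I_sq]
  ring_nf

/-- A Gaussian regression: `U - ρ V` is independent of `V`. -/
lemma ProbabilityTheory.HasGaussianLaw.integral_mul_cexp
    (h : HasGaussianLaw (fun ω => (U ω, V ω)) P) (hU0 : P[U] = 0) (hV0 : P[V] = 0)
    (hV1 : Var[V; P] = 1) (s : ℝ) :
    ∫ ω, (U ω : ℂ) * Complex.exp (Complex.I * s * V ω) ∂P
      = cov[U, V; P] * (Complex.I * s * Real.exp (-s ^ 2 / 2)) := by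
  have := h.isProbabilityMeasure
  set r := cov[U, V; P] with hr
  have hU := h.fst
  have hV := h.snd
  have hW : HasGaussianLaw (fun ω => (U ω - r * V ω, V ω)) P :=
    h.map_fun ((ContinuousLinearMap.fst ℝ ℝ ℝ - r • ContinuousLinearMap.snd ℝ ℝ ℝ).prod
      (ContinuousLinearMap.snd ℝ ℝ ℝ))
  have hcov : cov[fun ω => U ω - r * V ω, V; P] = 0 := by
    rw [covariance_fun_sub_left hU.memLp_two (hV.memLp_two.const_mul r) hV.memLp_two,
      covariance_const_mul_left, covariance_self hV.aemeasurable, hV1, ← hr]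
    ring
  have hind := hW.indepFun_of_covariance_eq_zero hcov
  have hmean : ∫ ω, (U ω - r * V ω) ∂P = 0 := by
    rw [integral_sub hU.integrable (hV.integrable.const_mul r), integral_const_mul, hU0, hV0]
    simp
  have e1 : ∫ ω, ((U ω - r * V ω : ℝ) : ℂ) * Complex.exp (Complex.I * s * V ω) ∂P = 0 := by
    rw [hind.integral_fun_comp_mul_comp (f := fun x : ℝ => (x : ℂ))
      (g := fun x : ℝ => Complex.exp (Complex.I * s * x)) hW.fst.aemeasurable hV.aemeasurable
      (by fun_prop) (by fun_prop), integral_complex_ofReal, hmean]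
    simp
  have i1 : Integrable (fun ω => ((U ω - r * V ω : ℝ) : ℂ) * Complex.exp (Complex.I * s * V ω)) P :=
    hW.fst.integrable.ofReal.mul_bdd (c := 1)
      (AEMeasurable.aestronglyMeasurable (by have := hV.aemeasurable; fun_prop))
      (Eventually.of_forall fun ω => (norm_cexp_I_mul_mul _ _).le)
  have i2 : Integrable (fun ω => (V ω : ℂ) * Complex.exp (Complex.I * s * V ω)) P :=
    hV.integrable.ofReal.mul_bdd (c := 1)
      (AEMeasurable.aestronglyMeasurable (by have := hV.aemeasurable; fun_prop))
      (Eventually.of_forall fun ω => (norm_cexp_I_mul_mul _ _).le)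
  calc ∫ ω, (U ω : ℂ) * Complex.exp (Complex.I * s * V ω) ∂P
      = ∫ ω, (((U ω - r * V ω : ℝ) : ℂ) * Complex.exp (Complex.I * s * V ω)
          + r * ((V ω : ℂ) * Complex.exp (Complex.I * s * V ω))) ∂P := by
        congr 1; ext ω; push_cast; ring
    _ = _ := by
        rw [integral_add i1 (i2.const_mul _), e1, integral_const_mul,
          hV.integral_mul_cexp_self hV0 hV1, zero_add]

lemma integrable_centeredExp [IsFiniteMeasure P] (hV : AEMeasurable V P) (s : ℝ) :
    Integrable (fun ω => centeredExp s (V ω)) P :=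
  Integrable.of_bound (AEMeasurable.aestronglyMeasurable (by unfold centeredExp; fun_prop)) 2
    (Eventually.of_forall fun _ => norm_centeredExp_le_two _ _)

lemma MeasureTheory.Integrable.mul_centeredExp {f : Ω → ℂ} (hf : Integrable f P)
    (hV : AEMeasurable V P) (s : ℝ) : Integrable (fun ω => f ω * centeredExp s (V ω)) P :=
  hf.mul_bdd (c := 2) (AEMeasurable.aestronglyMeasurable (by unfold centeredExp; fun_prop))
    (Eventually.of_forall fun _ => norm_centeredExp_le_two _ _)

lemma ProbabilityTheory.HasGaussianLaw.integral_mul_centeredExp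
    (h : HasGaussianLaw (fun ω => (U ω, V ω)) P) (hU0 : P[U] = 0) (hV0 : P[V] = 0)
    (hV1 : Var[V; P] = 1) (s : ℝ) :
    ∫ ω, (U ω : ℂ) * centeredExp s (V ω) ∂P
      = cov[U, V; P] * (Complex.I * s * Real.exp (-s ^ 2 / 2)) := by
  have i1 : Integrable (fun ω => (U ω : ℂ) * Complex.exp (Complex.I * s * V ω)) P :=
    h.fst.integrable.ofReal.mul_bdd (c := 1)
      (AEMeasurable.aestronglyMeasurable (by have := h.snd.aemeasurable; fun_prop))
      (Eventually.of_forall fun ω => (norm_cexp_I_mul_mul _ _).le)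
  simp only [centeredExp, mul_sub]
  rw [integral_sub i1 (by exact h.fst.integrable.ofReal.mul_const _),
    h.integral_mul_cexp hU0 hV0 hV1, integral_mul_const, integral_complex_ofReal, hU0]
  simp

lemma ProbabilityTheory.HasGaussianLaw.integral_cexp (hU : HasGaussianLaw U P) (hU0 : P[U] = 0)
    (hU1 : Var[U; P] = 1) (s : ℝ) :
    ∫ ω, Complex.exp (Complex.I * s * U ω) ∂P = Real.exp (-s ^ 2 / 2) := by
  have := hU.complexMGF_of_mean_zero hU0 (Complex.I * s)
  rw [complexMGF, hU1] at this
  rw [this, mul_pow, Complex.I_sq]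
  push_cast; ring_nf

/-- The covariance kernel of centred exponentials, for a standard Gaussian pair. -/
lemma ProbabilityTheory.HasGaussianLaw.integral_centeredExp_mul_centeredExp
    (h : HasGaussianLaw (fun ω => (U ω, V ω)) P) (hU0 : P[U] = 0) (hU1 : Var[U; P] = 1)
    (hV0 : P[V] = 0) (hV1 : Var[V; P] = 1) (s t : ℝ) :
    ∫ ω, centeredExp s (U ω) * centeredExp t (V ω) ∂P
      = ((Real.exp (-(s ^ 2 + t ^ 2) / 2) * (Real.exp (-(s * t * cov[U, V; P])) - 1) : ℝ) : ℂ) := by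
  have := h.isProbabilityMeasure
  have hUm := h.fst.aemeasurable
  have hVm := h.snd.aemeasurable
  have hW : HasGaussianLaw (fun ω => s * U ω + t * V ω) P :=
    h.map_fun (s • ContinuousLinearMap.fst ℝ ℝ ℝ + t • ContinuousLinearMap.snd ℝ ℝ ℝ)
  have hW0 : ∫ ω, (s * U ω + t * V ω) ∂P = 0 := by
    rw [integral_add (h.fst.integrable.const_mul s) (h.snd.integrable.const_mul t),
      integral_const_mul, integral_const_mul, hU0, hV0]
    simp
  have hW1 : Var[fun ω => s * U ω + t * V ω; P] = s ^ 2 + t ^ 2 + 2 * s * t * cov[U, V; P] := by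
    rw [variance_fun_add (h.fst.memLp_two.const_mul s) (h.snd.memLp_two.const_mul t),
      variance_const_mul, variance_const_mul, covariance_const_mul_left,
      covariance_const_mul_right, hU1, hV1]
    ring
  have e1 := hW.complexMGF_of_mean_zero hW0 Complex.I
  rw [complexMGF, hW1] at e1
  have iU : ∀ s : ℝ, Integrable (fun ω => Complex.exp (Complex.I * s * U ω)) P := fun s =>
    Integrable.of_bound (AEMeasurable.aestronglyMeasurable (by fun_prop)) 1
      (Eventually.of_forall fun _ => (norm_cexp_I_mul_mul _ _).le)
  have iW : Integrable (fun ω => Complex.exp (Complex.I * (s * U ω + t * V ω : ℝ))) P :=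
    Integrable.of_bound (AEMeasurable.aestronglyMeasurable (by fun_prop)) 1
      (Eventually.of_forall fun ω => by simpa using (norm_cexp_I_mul_mul 1 (s * U ω + t * V ω)).le)
  have key : ∀ ω, centeredExp s (U ω) * centeredExp t (V ω)
      = Complex.exp (Complex.I * (s * U ω + t * V ω : ℝ))
        - Complex.exp (Complex.I * s * U ω) * Real.exp (-t ^ 2 / 2)
        - Real.exp (-s ^ 2 / 2) * centeredExp t (V ω) := by
    intro ω
    simp only [centeredExp]
    rw [show Complex.I * ((s * U ω + t * V ω : ℝ) : ℂ)
      = Complex.I * s * U ω + Complex.I * t * V ω by push_cast; ring, Complex.exp_add]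
    ring
  have hc : ∫ ω, centeredExp t (V ω) ∂P = 0 := by
    simp only [centeredExp]
    rw [integral_sub _ (integrable_const _), h.snd.integral_cexp hV0 hV1]
    · simp
    · exact Integrable.of_bound (AEMeasurable.aestronglyMeasurable (by fun_prop)) 1
        (Eventually.of_forall fun _ => (norm_cexp_I_mul_mul _ _).le)
  simp_rw [key]
  rw [integral_sub (by exact iW.sub ((iU s).mul_const _))
      ((integrable_centeredExp hVm t).const_mul _),
    integral_sub iW ((iU s).mul_const _), integral_const_mul, integral_mul_const, hc,
    h.fst.integral_cexp hU0 hU1, e1, Complex.I_sq, mul_zero, sub_zero, mul_neg_one,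
    ← Complex.ofReal_neg]
  norm_cast
  rw [← Real.exp_add, mul_sub, ← Real.exp_add, mul_one]
  congr 2 <;> ring_nf

end GaussianPair

/-! ### Second moments of the summands -/

namespace IsStandardStationaryGaussian

variable {Ω : Type*} [MeasurableSpace Ω] {P : Measure Ω} {X : ℕ → Ω → ℝ}

lemma hasGaussianLaw_prodMk (hX : IsStandardStationaryGaussian X P) (j k : ℕ) :
    HasGaussianLaw (fun ω => (X j ω, X k ω)) P := hX.gaussian.hasGaussianLaw_prodMk

lemma mean (hX : IsStandardStationaryGaussian X P) (k : ℕ) : P[X k] = 0 :=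
  (hX.stationary.mean_eq k).trans hX.mean_zero

lemma cov_eq_autocov (hX : IsStandardStationaryGaussian X P) (j k : ℕ) :
    cov[X j, X k; P] = autocov X P (Nat.dist j k) := by
  wlog h : j ≤ k generalizing j k
  · rw [covariance_comm, Nat.dist_comm]
    exact this k j (by omega)
  · obtain ⟨m, rfl⟩ := Nat.exists_eq_add_of_le h
    rw [hX.stationary.cov_eq, autocov, Nat.dist_eq_sub_of_le h, Nat.add_sub_cancel_left]

lemma autocov_zero (hX : IsStandardStationaryGaussian X P) : autocov X P 0 = 1 := by
  rw [autocov, covariance_self (hX.measurable 0).aemeasurable, hX.var_one]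

lemma variance_eq_one (hX : IsStandardStationaryGaussian X P) (k : ℕ) : Var[X k; P] = 1 := by
  rw [← covariance_self (hX.measurable k).aemeasurable, hX.cov_eq_autocov, Nat.dist_self,
    hX.autocov_zero]

lemma integral_mul [IsProbabilityMeasure P] (hX : IsStandardStationaryGaussian X P) (j k : ℕ) :
    ∫ ω, X j ω * X k ω ∂P = autocov X P (Nat.dist j k) := by
  rw [← hX.cov_eq_autocov, covariance_eq_sub (hX.stationary.memLp_two j)
    (hX.stationary.memLp_two k), hX.mean]
  simp

lemma abs_autocov_le_one [IsProbabilityMeasure P] (hX : IsStandardStationaryGaussian X P) (k : ℕ) :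
    |autocov X P k| ≤ 1 := by
  have h0 := hX.stationary.memLp_two 0
  have hk := hX.stationary.memLp_two k
  have h1 := variance_nonneg (X 0 + X k) P
  have h2 := variance_nonneg (X 0 - X k) P
  rw [variance_add h0 hk, hX.variance_eq_one, hX.variance_eq_one] at h1
  rw [variance_sub h0 hk, hX.variance_eq_one, hX.variance_eq_one] at h2
  rw [autocov, abs_le]
  constructor <;> linarith

lemma marginalCharFun_eq (hX : IsStandardStationaryGaussian X P) (s : ℝ) :
    marginalCharFun X P s = Real.exp (-s ^ 2 / 2) :=
  (hX.gaussian.hasGaussianLaw_eval 0).integral_cexp (hX.mean 0) hX.var_one s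

lemma integral_centeredExp_mul_conj (hX : IsStandardStationaryGaussian X P) (s : ℝ) (j k : ℕ) :
    ∫ ω, centeredExp s (X j ω) * (starRingEnd ℂ) (centeredExp s (X k ω)) ∂P
      = ((Real.exp (-s ^ 2) * (Real.exp (s ^ 2 * autocov X P (Nat.dist j k)) - 1) : ℝ) : ℂ) := by
  simp_rw [conj_centeredExp]
  rw [(hX.hasGaussianLaw_prodMk j k).integral_centeredExp_mul_centeredExp (hX.mean j)
    (hX.variance_eq_one j) (hX.mean k) (hX.variance_eq_one k), hX.cov_eq_autocov]
  congr 3 <;> ring_nf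

lemma integral_mul_conj_centeredExp (hX : IsStandardStationaryGaussian X P) (s : ℝ) (j k : ℕ) :
    ∫ ω, (X j ω : ℂ) * (starRingEnd ℂ) (centeredExp s (X k ω)) ∂P
      = -(autocov X P (Nat.dist j k) * (Complex.I * s * Real.exp (-s ^ 2 / 2))) := by
  simp_rw [conj_centeredExp]
  rw [(hX.hasGaussianLaw_prodMk j k).integral_mul_centeredExp (hX.mean j) (hX.mean k)
    (hX.variance_eq_one k), hX.cov_eq_autocov]
  push_cast; ring_nf

lemma integral_centeredExp_mul (hX : IsStandardStationaryGaussian X P) (s : ℝ) (j k : ℕ) :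
    ∫ ω, centeredExp s (X j ω) * (X k ω : ℂ) ∂P
      = autocov X P (Nat.dist j k) * (Complex.I * s * Real.exp (-s ^ 2 / 2)) := by
  simp_rw [mul_comm (centeredExp s _)]
  rw [(hX.hasGaussianLaw_prodMk k j).integral_mul_centeredExp (hX.mean k) (hX.mean j)
    (hX.variance_eq_one j), hX.cov_eq_autocov, Nat.dist_comm]

lemma integrable_mul [IsProbabilityMeasure P] (hX : IsStandardStationaryGaussian X P) (j k : ℕ) :
    Integrable (fun ω => (X j ω : ℂ) * X k ω) P := by
  simpa using ((hX.stationary.memLp_two j).integrable_mul (hX.stationary.memLp_two k)).ofReal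
    (𝕜 := ℂ)

end IsStandardStationaryGaussian

/-- The coefficient of `x y` in the Hermite expansion of `centeredExp s x * centeredExp t y`, with
the sign reversed. -/
noncomputable def leadingCoeff (s t : ℝ) : ℝ :=
  Real.exp (-s ^ 2 / 2) * s * (Real.exp (-t ^ 2 / 2) * t)

/-- The summand of `reductionError`: the remainder of `centeredExp s x * centeredExp t y` after
removal of the leading term of its Hermite expansion. -/
noncomputable def hermiteRemainder (s t x y : ℝ) : ℂ :=
  centeredExp s x * centeredExp t y + leadingCoeff s t * (x * y)

@[fun_prop]
lemma measurable_hermiteRemainder {α : Type*} [MeasurableSpace α] {s t x y : α → ℝ}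
    (hs : Measurable s) (ht : Measurable t) (hx : Measurable x) (hy : Measurable y) :
    Measurable fun a => hermiteRemainder (s a) (t a) (x a) (y a) := by
  unfold hermiteRemainder leadingCoeff centeredExp; fun_prop

section TwoProcesses

variable {Ω : Type*} [MeasurableSpace Ω] {P : Measure Ω} {X Y : ℕ → Ω → ℝ}

lemma reductionError_eq_mean (hX : IsStandardStationaryGaussian X P)
    (hY : IsStandardStationaryGaussian Y P) (n : ℕ) (ω : Ω) (p : ℝ × ℝ) :
    reductionError X Y P n ω p
      = (1 / (n : ℂ)) * ∑ j ∈ Finset.range n, hermiteRemainder p.1 p.2 (X j ω) (Y j ω) := by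
  simp only [reductionError, hX.marginalCharFun_eq, hY.marginalCharFun_eq, hermiteRemainder,
    leadingCoeff, Finset.sum_add_distrib, centeredExp, mul_add, ← Finset.mul_sum]
  push_cast
  ring

/-- The covariance of two Hermite remainders as a function of the covariances `a` and `b` of the
underlying standard Gaussian pairs. -/
noncomputable def remainderCov (s t a b : ℝ) : ℝ :=
  Real.exp (-s ^ 2) * Real.exp (-t ^ 2) *
    ((Real.exp (s ^ 2 * a) - 1) * (Real.exp (t ^ 2 * b) - 1) - s ^ 2 * a * (t ^ 2 * b))

lemma integrable_hermiteRemainder_mul_conj_and_integral_eq [IsProbabilityMeasure P]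
    (hX : IsStandardStationaryGaussian X P)
    (hY : IsStandardStationaryGaussian Y P)
    (hXY : IndepFun (fun ω k => X k ω) (fun ω k => Y k ω) P) (s t : ℝ) (j k : ℕ) :
    Integrable (fun ω => hermiteRemainder s t (X j ω) (Y j ω) *
        (starRingEnd ℂ) (hermiteRemainder s t (X k ω) (Y k ω))) P ∧
    ∫ ω, hermiteRemainder s t (X j ω) (Y j ω) *
        (starRingEnd ℂ) (hermiteRemainder s t (X k ω) (Y k ω)) ∂P
      = (remainderCov s t (autocov X P (Nat.dist j k)) (autocov Y P (Nat.dist j k)) : ℂ) := by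
  -- Every term is a product of a function of `X` and a function of `Y`.
  have main : ∀ f g : ℝ → ℝ → ℂ, Measurable (Function.uncurry f) → Measurable (Function.uncurry g) →
      Integrable (fun ω => f (X j ω) (X k ω)) P → Integrable (fun ω => g (Y j ω) (Y k ω)) P →
      Integrable (fun ω => f (X j ω) (X k ω) * g (Y j ω) (Y k ω)) P ∧
      ∫ ω, f (X j ω) (X k ω) * g (Y j ω) (Y k ω) ∂P
        = (∫ ω, f (X j ω) (X k ω) ∂P) * ∫ ω, g (Y j ω) (Y k ω) ∂P := by
    intro f g hf hg hfi hgi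
    have hind : IndepFun (fun ω => f (X j ω) (X k ω)) (fun ω => g (Y j ω) (Y k ω)) P :=
      hXY.comp (φ := Function.uncurry f ∘ fun x : ℕ → ℝ => (x j, x k))
        (ψ := Function.uncurry g ∘ fun x : ℕ → ℝ => (x j, x k))
        (hf.comp ((measurable_pi_apply j).prodMk (measurable_pi_apply k)))
        (hg.comp ((measurable_pi_apply j).prodMk (measurable_pi_apply k)))
    exact ⟨hind.integrable_mul hfi hgi, hind.integral_fun_mul_eq_mul_integral
      hfi.aestronglyMeasurable hgi.aestronglyMeasurable⟩
  have int1 : ∀ {Z : ℕ → Ω → ℝ}, IsStandardStationaryGaussian Z P → ∀ (s : ℝ) (j k : ℕ),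
      Integrable (fun ω => (Z j ω : ℂ) * (starRingEnd ℂ) (centeredExp s (Z k ω))) P := by
    intro Z hZ s j k
    simp_rw [conj_centeredExp]
    exact (hZ.gaussian.hasGaussianLaw_eval j).integrable.ofReal.mul_centeredExp
      (hZ.measurable k).aemeasurable _
  have int2 : ∀ {Z : ℕ → Ω → ℝ}, IsStandardStationaryGaussian Z P → ∀ (s : ℝ) (j k : ℕ),
      Integrable (fun ω => centeredExp s (Z j ω) * (Z k ω : ℂ)) P := by
    intro Z hZ s j k
    simp_rw [mul_comm (centeredExp s _)]
    exact (hZ.gaussian.hasGaussianLaw_eval k).integrable.ofReal.mul_centeredExp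
      (hZ.measurable j).aemeasurable _
  have int3 : ∀ {Z : ℕ → Ω → ℝ}, IsStandardStationaryGaussian Z P → ∀ (s : ℝ) (j k : ℕ),
      Integrable (fun ω => centeredExp s (Z j ω) * (starRingEnd ℂ) (centeredExp s (Z k ω))) P := by
    intro Z hZ s j k
    simp_rw [conj_centeredExp]
    exact (integrable_centeredExp (hZ.measurable j).aemeasurable _).mul_centeredExp
      (hZ.measurable k).aemeasurable _
  obtain ⟨i1, e1⟩ := main (fun x y => centeredExp s x * (starRingEnd ℂ) (centeredExp s y))
    (fun x y => centeredExp t x * (starRingEnd ℂ) (centeredExp t y))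
    (by simp_rw [conj_centeredExp, Function.uncurry_def]; fun_prop)
    (by simp_rw [conj_centeredExp, Function.uncurry_def]; fun_prop) (int3 hX s j k) (int3 hY t j k)
  obtain ⟨i2, e2⟩ := main (fun x y => x * (starRingEnd ℂ) (centeredExp s y))
    (fun x y => x * (starRingEnd ℂ) (centeredExp t y))
    (by simp_rw [conj_centeredExp, Function.uncurry_def]; fun_prop)
    (by simp_rw [conj_centeredExp, Function.uncurry_def]; fun_prop) (int1 hX s j k) (int1 hY t j k)
  obtain ⟨i3, e3⟩ := main (fun x y => centeredExp s x * y) (fun x y => centeredExp t x * y)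
    (by rw [Function.uncurry_def]; fun_prop) (by rw [Function.uncurry_def]; fun_prop)
    (int2 hX s j k) (int2 hY t j k)
  obtain ⟨i4, e4⟩ := main (fun x y => (x : ℂ) * y) (fun x y => (x : ℂ) * y)
    (by rw [Function.uncurry_def]; fun_prop) (by rw [Function.uncurry_def]; fun_prop)
    (hX.integrable_mul j k) (hY.integrable_mul j k)
  have hXm : ∫ ω, (X j ω : ℂ) * X k ω ∂P = autocov X P (Nat.dist j k) := by
    rw [← hX.integral_mul, ← integral_complex_ofReal]; push_cast; rfl
  have hYm : ∫ ω, (Y j ω : ℂ) * Y k ω ∂P = autocov Y P (Nat.dist j k) := by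
    rw [← hY.integral_mul, ← integral_complex_ofReal]; push_cast; rfl
  rw [hX.integral_centeredExp_mul_conj, hY.integral_centeredExp_mul_conj] at e1
  rw [hX.integral_mul_conj_centeredExp, hY.integral_mul_conj_centeredExp] at e2
  rw [hX.integral_centeredExp_mul, hY.integral_centeredExp_mul] at e3
  rw [hXm, hYm] at e4
  set κ : ℂ := (leadingCoeff s t : ℂ) with hκ
  have hexp : (fun ω => hermiteRemainder s t (X j ω) (Y j ω) *
        (starRingEnd ℂ) (hermiteRemainder s t (X k ω) (Y k ω))) = fun ω =>
      centeredExp s (X j ω) * (starRingEnd ℂ) (centeredExp s (X k ω)) *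
        (centeredExp t (Y j ω) * (starRingEnd ℂ) (centeredExp t (Y k ω)))
      + κ * (X j ω * (starRingEnd ℂ) (centeredExp s (X k ω)) *
        (Y j ω * (starRingEnd ℂ) (centeredExp t (Y k ω))))
      + κ * (centeredExp s (X j ω) * X k ω * (centeredExp t (Y j ω) * Y k ω))
      + κ ^ 2 * (X j ω * X k ω * (Y j ω * Y k ω)) := by
    ext ω
    simp only [hermiteRemainder, map_add, map_mul, Complex.conj_ofReal]
    ring
  have j2 := i2.const_mul κ
  have j3 := i3.const_mul κ
  have j4 := i4.const_mul (κ ^ 2)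
  rw [hexp]
  refine ⟨((i1.add j2).add j3).add j4, ?_⟩
  rw [integral_add (by exact (i1.add j2).add j3) j4, integral_add (by exact i1.add j2) j3,
    integral_add i1 j2, integral_const_mul, integral_const_mul, integral_const_mul, e1, e2, e3, e4,
    hκ, leadingCoeff, remainderCov]
  have hs : Real.exp (-s ^ 2) = Real.exp (-s ^ 2 / 2) ^ 2 := by
    rw [← Real.exp_nat_mul]; ring_nf
  have ht : Real.exp (-t ^ 2) = Real.exp (-t ^ 2 / 2) ^ 2 := by
    rw [← Real.exp_nat_mul]; ring_nf
  rw [hs, ht]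
  push_cast
  linear_combination (2 * (s : ℂ) ^ 2 * t ^ 2 * autocov X P (Nat.dist j k)
    * autocov Y P (Nat.dist j k) * Complex.exp (-(s : ℂ) ^ 2 / 2) ^ 2
    * Complex.exp (-(t : ℂ) ^ 2 / 2) ^ 2) * Complex.I_sq

end TwoProcesses

/-! ### Bounds for the covariance of the remainders -/

/-- The power series of both sides compare term by term, since `|r| ^ n ≤ |r| ^ m` for `m ≤ n`. -/
lemma abs_exp_mul_sub_one_le {x r : ℝ} (hx : 0 ≤ x) (hr : |r| ≤ 1) :
    |Real.exp (x * r) - 1| ≤ |r| * (Real.exp x - 1) ∧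
      |Real.exp (x * r) - 1 - x * r| ≤ r ^ 2 * (Real.exp x - 1 - x) := by
  have hs : ∀ y : ℝ, HasSum (fun n : ℕ => y ^ n / n.factorial) (Real.exp y) := fun y => by
    rw [Real.exp_eq_exp_ℝ]; exact NormedSpace.expSeries_div_hasSum_exp y
  have h1 : ∀ y : ℝ, HasSum (fun n : ℕ => y ^ (n + 1) / (n + 1).factorial) (Real.exp y - 1) :=
    fun y => by simpa using (hasSum_nat_add_iff' 1).2 (hs y)
  have h2 : ∀ y : ℝ, HasSum (fun n : ℕ => y ^ (n + 2) / (n + 2).factorial) (Real.exp y - 1 - y) :=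
    fun y => by simpa [Finset.sum_range_succ, sub_sub] using (hasSum_nat_add_iff' 2).2 (hs y)
  have hp : ∀ m n : ℕ, ‖(x * r) ^ (n + m) / (n + m).factorial‖
      ≤ |r| ^ m * (x ^ (n + m) / (n + m).factorial) := by
    intro m n
    rw [norm_div, norm_pow, norm_mul, Real.norm_of_nonneg hx, Real.norm_eq_abs, RCLike.norm_natCast,
      mul_pow, ← mul_div_assoc, mul_comm]
    gcongr ?_ * _ / _
    exact pow_le_pow_of_le_one (abs_nonneg r) hr (by omega)
  have b1 := tsum_of_norm_bounded ((h1 x).mul_left (|r| ^ 1)) (hp 1)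
  have b2 := tsum_of_norm_bounded ((h2 x).mul_left (|r| ^ 2)) (hp 2)
  rw [(h1 _).tsum_eq] at b1
  rw [(h2 _).tsum_eq] at b2
  rw [sq_abs] at b2
  exact ⟨by simpa using b1, b2⟩

/-- The integrable majorant of all functions of one frequency: relative to `s⁻² ds` it has finite
mass. -/
noncomputable def freqMajorant (s : ℝ) : ℝ := s ^ 2 / (1 + s ^ 2)

lemma freqMajorant_nonneg (s : ℝ) : 0 ≤ freqMajorant s := by unfold freqMajorant; positivity

lemma le_mul_freqMajorant {s A a b : ℝ} (h0 : A ≤ b) (h1 : A ≤ a * s ^ 2) :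
    A ≤ (a + b) * freqMajorant s := by
  rw [freqMajorant, ← mul_div_assoc, le_div_iff₀ (by positivity)]
  nlinarith [sq_nonneg s]

lemma one_sub_exp_neg_sq_le (s : ℝ) : 1 - Real.exp (-s ^ 2) ≤ 2 * freqMajorant s := by
  have := le_mul_freqMajorant (s := s) (A := 1 - Real.exp (-s ^ 2)) (a := 1) (b := 1)
    (by linarith [Real.exp_pos (-s ^ 2)]) (by linarith [Real.add_one_le_exp (-s ^ 2)])
  linarith

lemma abs_remainderCov_le {a b : ℝ} (ha : |a| ≤ 1) (hb : |b| ≤ 1) (s t : ℝ) :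
    |remainderCov s t a b|
      ≤ 4 * (a ^ 2 * |b| + |a| * b ^ 2) * (freqMajorant s * freqMajorant t) := by
  obtain ⟨a1, a2⟩ := abs_exp_mul_sub_one_le (sq_nonneg s) ha
  obtain ⟨b1, b2⟩ := abs_exp_mul_sub_one_le (sq_nonneg t) hb
  have hs : s ^ 2 + 1 ≤ Real.exp (s ^ 2) := Real.add_one_le_exp _
  have ht : t ^ 2 + 1 ≤ Real.exp (t ^ 2) := Real.add_one_le_exp _
  have hs0 := sq_nonneg s
  have ht0 := sq_nonneg t
  have ha' : |s ^ 2 * a| ≤ |a| * (Real.exp (s ^ 2) - 1) := by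
    rw [abs_mul, abs_of_nonneg hs0, mul_comm]; gcongr; linarith
  have a2' : |Real.exp (s ^ 2 * a) - 1 - s ^ 2 * a| ≤ a ^ 2 * (Real.exp (s ^ 2) - 1) :=
    a2.trans (mul_le_mul_of_nonneg_left (by linarith) (sq_nonneg a))
  have b2' : |Real.exp (t ^ 2 * b) - 1 - t ^ 2 * b| ≤ b ^ 2 * (Real.exp (t ^ 2) - 1) :=
    b2.trans (mul_le_mul_of_nonneg_left (by linarith) (sq_nonneg b))
  have hes : 0 ≤ Real.exp (s ^ 2) - 1 := by linarith
  have het : 0 ≤ Real.exp (t ^ 2) - 1 := by linarith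
  have key : |(Real.exp (s ^ 2 * a) - 1) * (Real.exp (t ^ 2 * b) - 1) - s ^ 2 * a * (t ^ 2 * b)|
      ≤ (a ^ 2 * |b| + |a| * b ^ 2) * ((Real.exp (s ^ 2) - 1) * (Real.exp (t ^ 2) - 1)) := by
    rw [show (Real.exp (s ^ 2 * a) - 1) * (Real.exp (t ^ 2 * b) - 1) - s ^ 2 * a * (t ^ 2 * b)
      = (Real.exp (s ^ 2 * a) - 1 - s ^ 2 * a) * (Real.exp (t ^ 2 * b) - 1)
        + s ^ 2 * a * (Real.exp (t ^ 2 * b) - 1 - t ^ 2 * b) by ring]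
    refine (abs_add_le _ _).trans ?_
    rw [abs_mul, abs_mul (s ^ 2 * a)]
    have m1 := mul_le_mul a2' b1 (abs_nonneg _) (by positivity)
    have m2 := mul_le_mul ha' b2' (abs_nonneg _) (by positivity)
    linarith
  have es : Real.exp (-s ^ 2) * (Real.exp (s ^ 2) - 1) = 1 - Real.exp (-s ^ 2) := by
    rw [mul_sub, ← Real.exp_add]; simp
  have et : Real.exp (-t ^ 2) * (Real.exp (t ^ 2) - 1) = 1 - Real.exp (-t ^ 2) := by
    rw [mul_sub, ← Real.exp_add]; simp
  have es0 : 0 ≤ 1 - Real.exp (-s ^ 2) := by rw [← es]; positivity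
  rw [remainderCov, abs_mul, abs_of_pos (by positivity)]
  calc _ ≤ Real.exp (-s ^ 2) * Real.exp (-t ^ 2) * ((a ^ 2 * |b| + |a| * b ^ 2) *
          ((Real.exp (s ^ 2) - 1) * (Real.exp (t ^ 2) - 1))) := by gcongr
    _ = (a ^ 2 * |b| + |a| * b ^ 2) * ((Real.exp (-s ^ 2) * (Real.exp (s ^ 2) - 1)) *
          (Real.exp (-t ^ 2) * (Real.exp (t ^ 2) - 1))) := by ring
    _ ≤ (a ^ 2 * |b| + |a| * b ^ 2) * ((2 * freqMajorant s) * (2 * freqMajorant t)) := by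
        rw [es, et]
        have := freqMajorant_nonneg s
        gcongr
        · rw [← et]; positivity
        · exact one_sub_exp_neg_sq_le s
        · exact one_sub_exp_neg_sq_le t
    _ = _ := by ring

/-! ### Integrability with respect to the weight of the distance covariance -/

lemma lintegral_freqMajorant_mul_lt_top {c : ℝ} (hc : 0 < c) :
    ∫⁻ p : ℝ × ℝ, ENNReal.ofReal (freqMajorant p.1 * freqMajorant p.2) ∂(dcovMeasure c) < ⊤ := by
  have hm : Measurable fun p : ℝ × ℝ => ENNReal.ofReal (freqMajorant p.1 * freqMajorant p.2) := by
    unfold freqMajorant; fun_prop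
  rw [dcovMeasure, lintegral_withDensity_eq_lintegral_mul _ (by fun_prop) hm]
  have hi : Integrable (fun p : ℝ × ℝ => (c ^ 2)⁻¹ * ((1 + p.1 ^ 2)⁻¹ * (1 + p.2 ^ 2)⁻¹))
      (volume : Measure (ℝ × ℝ)) :=
    (integrable_inv_one_add_sq.mul_prod integrable_inv_one_add_sq).const_mul _
  refine lt_of_le_of_lt (lintegral_mono fun p => ?_) hi.lintegral_lt_top
  simp only [Pi.mul_apply]
  rw [← ENNReal.ofReal_mul (by positivity)]
  refine ENNReal.ofReal_le_ofReal ?_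
  have hle : ∀ x : ℝ, (x ^ 2)⁻¹ * freqMajorant x ≤ (1 + x ^ 2)⁻¹ := by
    intro x
    unfold freqMajorant
    rcases eq_or_ne x 0 with rfl | hx
    · simp
    · rw [← mul_div_assoc, inv_mul_cancel₀ (by positivity), one_div]
  calc (c ^ 2 * p.1 ^ 2 * p.2 ^ 2)⁻¹ * (freqMajorant p.1 * freqMajorant p.2)
      = (c ^ 2)⁻¹ * (((p.1 ^ 2)⁻¹ * freqMajorant p.1) * ((p.2 ^ 2)⁻¹ * freqMajorant p.2)) := by
        rw [mul_inv, mul_inv]; ring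
    _ ≤ _ := by
        gcongr
        · exact mul_nonneg (by positivity) (freqMajorant_nonneg _)
        · exact hle _
        · exact hle _

lemma norm_centeredExp_sq_le (s x : ℝ) :
    ‖centeredExp s x‖ ^ 2 ≤ ((|x| + 1) ^ 2 + 4) * freqMajorant s := by
  refine le_mul_freqMajorant ?_ ?_
  · nlinarith [norm_centeredExp_le_two s x, norm_nonneg (centeredExp s x)]
  · rw [← sq_abs s, ← mul_pow]
    gcongr
    have h1 : ‖Complex.exp (Complex.I * s * x) - 1‖ ≤ |x| * |s| := by
      rw [show Complex.I * s * x = Complex.I * ((s * x : ℝ) : ℂ) by push_cast; ring]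
      refine (Real.norm_exp_I_mul_ofReal_sub_one_le).trans ?_
      rw [norm_mul, mul_comm, Real.norm_eq_abs, Real.norm_eq_abs]
    have h2 : |1 - Real.exp (-s ^ 2 / 2)| ≤ |s| := by
      rw [abs_of_nonneg (by
        rw [sub_nonneg]; exact Real.exp_le_one_iff.2 (by nlinarith [sq_nonneg s]))]
      rcases le_total |s| 1 with h | h
      · have := Real.add_one_le_exp (-s ^ 2 / 2)
        nlinarith [sq_abs s, abs_nonneg s]
      · linarith [Real.exp_pos (-s ^ 2 / 2)]
    rw [show centeredExp s x = (Complex.exp (Complex.I * s * x) - 1)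
      + ((1 - Real.exp (-s ^ 2 / 2) : ℝ) : ℂ) by rw [centeredExp]; push_cast; ring]
    refine (norm_add_le _ _).trans ?_
    rw [Complex.norm_real, Real.norm_eq_abs]
    linarith

lemma sq_exp_mul_le (s : ℝ) : (Real.exp (-s ^ 2 / 2) * s) ^ 2 ≤ freqMajorant s := by
  rw [freqMajorant, le_div_iff₀ (by positivity), mul_pow, ← Real.exp_nat_mul]
  have h := Real.add_one_le_exp (s ^ 2)
  calc Real.exp ((2 : ℕ) * (-s ^ 2 / 2)) * s ^ 2 * (1 + s ^ 2)
      ≤ Real.exp ((2 : ℕ) * (-s ^ 2 / 2)) * s ^ 2 * Real.exp (s ^ 2) := by gcongr; linarith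
    _ = s ^ 2 * (Real.exp ((2 : ℕ) * (-s ^ 2 / 2)) * Real.exp (s ^ 2)) := by ring
    _ = s ^ 2 := by rw [← Real.exp_add]; norm_num; ring_nf; simp

lemma memLp_hermiteRemainder {c : ℝ} (hc : 0 < c) (x y : ℝ) :
    MemLp (fun p : ℝ × ℝ => hermiteRemainder p.1 p.2 x y) 2 (dcovMeasure c) := by
  have hm : Measurable fun p : ℝ × ℝ => freqMajorant p.1 * freqMajorant p.2 := by
    unfold freqMajorant; fun_prop
  have hi : Integrable (fun p : ℝ × ℝ => freqMajorant p.1 * freqMajorant p.2) (dcovMeasure c) :=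
    ⟨hm.aestronglyMeasurable, (hasFiniteIntegral_iff_ofReal (Eventually.of_forall fun p =>
      mul_nonneg (freqMajorant_nonneg _) (freqMajorant_nonneg _))).2
      (lintegral_freqMajorant_mul_lt_top hc)⟩
  -- Square integrability follows from a pointwise bound by the product of the two majorants.
  have hprod : ∀ f : ℝ × ℝ → ℂ, Measurable f → ∀ K : ℝ,
      (∀ p, ‖f p‖ ^ 2 ≤ K * (freqMajorant p.1 * freqMajorant p.2)) → MemLp f 2 (dcovMeasure c) := by
    intro f hf K hK
    rw [memLp_two_iff_integrable_sq_norm hf.aestronglyMeasurable]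
    exact (hi.const_mul K).mono' (hf.norm.pow_const 2).aestronglyMeasurable
      (Eventually.of_forall fun p => by rw [Real.norm_of_nonneg (by positivity)]; exact hK p)
  refine MemLp.add (f := fun p : ℝ × ℝ => centeredExp p.1 x * centeredExp p.2 y)
    (g := fun p : ℝ × ℝ => (leadingCoeff p.1 p.2 : ℂ) * (x * y)) ?_ ?_
  · refine hprod _ (by unfold centeredExp; fun_prop) (((|x| + 1) ^ 2 + 4) * ((|y| + 1) ^ 2 + 4))
      fun p => ?_
    rw [norm_mul, mul_pow]
    have := mul_le_mul (norm_centeredExp_sq_le p.1 x) (norm_centeredExp_sq_le p.2 y)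
      (by positivity) (mul_nonneg (by positivity) (freqMajorant_nonneg _))
    linarith
  · refine hprod _ (by unfold leadingCoeff; fun_prop) ((x * y) ^ 2) fun p => ?_
    rw [← Complex.ofReal_mul, ← Complex.ofReal_mul, Complex.norm_real, Real.norm_eq_abs, sq_abs,
      mul_pow, mul_comm, leadingCoeff, mul_pow _ (_ * _)]
    have := mul_le_mul (sq_exp_mul_le p.1) (sq_exp_mul_le p.2) (by positivity)
      (freqMajorant_nonneg _)
    gcongr

/-! ### The second moment of the reduction error -/

lemma sum_sum_dist_le {f : ℕ → ℝ} (hf : ∀ k, 0 ≤ f k) (n : ℕ) :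
    ∑ j ∈ Finset.range n, ∑ k ∈ Finset.range n, f (Nat.dist j k)
      ≤ n * (2 * ∑ k ∈ Finset.range n, f k) := by
  have h : ∀ j ∈ Finset.range n,
      ∑ k ∈ Finset.range n, f (Nat.dist j k) ≤ 2 * ∑ k ∈ Finset.range n, f k := by
    intro j hj
    rw [← Finset.sum_fiberwise_of_maps_to (s := Finset.range n) (t := Finset.range n)
      (g := fun k => Nat.dist j k) (fun k hk => by
        rw [Finset.mem_range, Nat.dist] at *; omega), Finset.mul_sum]
    refine Finset.sum_le_sum fun m _ => ?_
    have hcard : ((Finset.range n).filter fun k => Nat.dist j k = m).card ≤ 2 := by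
      refine (Finset.card_le_card (t := {j + m, j - m}) fun k hk => ?_).trans Finset.card_le_two
      rw [Finset.mem_filter, Nat.dist] at hk
      rw [Finset.mem_insert, Finset.mem_singleton]
      omega
    calc _ = ∑ k ∈ (Finset.range n).filter fun k => Nat.dist j k = m, f m :=
          Finset.sum_congr rfl fun k hk => by rw [(Finset.mem_filter.1 hk).2]
      _ = ((Finset.range n).filter fun k => Nat.dist j k = m).card * f m := by
          rw [Finset.sum_const, nsmul_eq_mul]
      _ ≤ 2 * f m := mul_le_mul_of_nonneg_right (by exact_mod_cast hcard) (hf m)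
  simpa using Finset.sum_le_sum h

section TwoProcesses

variable {Ω : Type*} [MeasurableSpace Ω] {P : Measure Ω} {X Y : ℕ → Ω → ℝ}

lemma measurable_uncurry_reductionError (hX : IsStandardStationaryGaussian X P)
    (hY : IsStandardStationaryGaussian Y P) (n : ℕ) :
    Measurable (Function.uncurry (reductionError X Y P n)) := by
  have : Function.uncurry (reductionError X Y P n) = fun q : Ω × ℝ × ℝ => (1 / (n : ℂ)) *
      ∑ j ∈ Finset.range n, hermiteRemainder q.2.1 q.2.2 (X j q.1) (Y j q.1) := by
    ext ⟨ω, p⟩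
    exact reductionError_eq_mean hX hY n ω p
  rw [this]
  refine measurable_const.mul (Finset.measurable_sum _ fun j _ => ?_)
  exact measurable_hermiteRemainder (by fun_prop) (by fun_prop)
    ((hX.measurable j).comp measurable_fst) ((hY.measurable j).comp measurable_fst)

lemma memLp_reductionError (hX : IsStandardStationaryGaussian X P)
    (hY : IsStandardStationaryGaussian Y P) {c : ℝ} (hc : 0 < c) (n : ℕ) (ω : Ω) :
    MemLp (reductionError X Y P n ω) 2 (dcovMeasure c) := by
  rw [funext (reductionError_eq_mean hX hY n ω)]
  exact (memLp_finsetSum _ fun j _ => memLp_hermiteRemainder hc (X j ω) (Y j ω)).const_mul _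

lemma integral_norm_sq_reductionError [IsProbabilityMeasure P]
    (hX : IsStandardStationaryGaussian X P) (hY : IsStandardStationaryGaussian Y P)
    (hXY : IndepFun (fun ω k => X k ω) (fun ω k => Y k ω) P) (n : ℕ) (p : ℝ × ℝ) :
    Integrable (fun ω => ‖reductionError X Y P n ω p‖ ^ 2) P ∧
    ∫ ω, ‖reductionError X Y P n ω p‖ ^ 2 ∂P = (1 / (n : ℝ)) ^ 2 *
      ∑ j ∈ Finset.range n, ∑ k ∈ Finset.range n, remainderCov p.1 p.2
        (autocov X P (Nat.dist j k)) (autocov Y P (Nat.dist j k)) := by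
  have hI := fun j k =>
    (integrable_hermiteRemainder_mul_conj_and_integral_eq hX hY hXY p.1 p.2 j k)
  have e : ∀ ω, ((‖reductionError X Y P n ω p‖ ^ 2 : ℝ) : ℂ) = (1 / (n : ℂ)) ^ 2 *
      ∑ j ∈ Finset.range n, ∑ k ∈ Finset.range n, hermiteRemainder p.1 p.2 (X j ω) (Y j ω) *
        (starRingEnd ℂ) (hermiteRemainder p.1 p.2 (X k ω) (Y k ω)) := by
    intro ω
    rw [Complex.ofReal_pow, ← Complex.mul_conj', reductionError_eq_mean hX hY, map_mul, map_sum,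
      ← Finset.sum_mul_sum, map_div₀, map_one, Complex.conj_natCast]
    ring
  have hint : Integrable (fun ω => ((‖reductionError X Y P n ω p‖ ^ 2 : ℝ) : ℂ)) P := by
    simp_rw [e]
    exact (integrable_finsetSum _ fun j _ => integrable_finsetSum _ fun k _ =>
      (hI j k).1).const_mul _
  refine ⟨hint.re, ?_⟩
  rw [← Complex.ofReal_inj, ← integral_complex_ofReal]
  simp_rw [e]
  rw [integral_const_mul, integral_finsetSum _ fun j _ => integrable_finsetSum _ fun k _ =>
    (hI j k).1]
  push_cast
  congr 1
  refine Finset.sum_congr rfl fun j _ => ?_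
  rw [integral_finsetSum _ fun k _ => (hI j k).1]
  exact Finset.sum_congr rfl fun k _ => (hI j k).2

/-- The mean square of the reduction error at a point is controlled by the mean of `|ρ_X|³`. Lag
zero, where `ρ_Y = C ρ_X` may fail, accounts for the summand `2` of the constant. -/
lemma lintegral_enorm_sq_reductionError_le [IsProbabilityMeasure P]
    (hX : IsStandardStationaryGaussian X P) (hY : IsStandardStationaryGaussian Y P)
    (hXY : IndepFun (fun ω k => X k ω) (fun ω k => Y k ω) P) {C : ℝ}
    (hC : ∀ k : ℕ, 1 ≤ k → autocov Y P k = C * autocov X P k) (n : ℕ) (p : ℝ × ℝ) :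
    ∫⁻ ω, ‖reductionError X Y P n ω p‖ₑ ^ 2 ∂P ≤
      ENNReal.ofReal (8 * (|C| + C ^ 2 + 2) *
        ((1 / (n : ℝ)) * ∑ k ∈ Finset.range n, |autocov X P k| ^ 3)) *
      ENNReal.ofReal (freqMajorant p.1 * freqMajorant p.2) := by
  obtain ⟨hi, he⟩ := integral_norm_sq_reductionError hX hY hXY n p
  set F := freqMajorant p.1 * freqMajorant p.2 with hF
  have hF0 : 0 ≤ F := mul_nonneg (freqMajorant_nonneg _) (freqMajorant_nonneg _)
  set M := |C| + C ^ 2 + 2 with hM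
  have hM0 : 0 ≤ M := by positivity
  have hterm : ∀ d : ℕ, remainderCov p.1 p.2 (autocov X P d) (autocov Y P d)
      ≤ 4 * M * F * |autocov X P d| ^ 3 := by
    intro d
    refine (le_abs_self _).trans ((abs_remainderCov_le (hX.abs_autocov_le_one d)
      (hY.abs_autocov_le_one d) p.1 p.2).trans ?_)
    have hcub : autocov X P d ^ 2 * |autocov Y P d| + |autocov X P d| * autocov Y P d ^ 2
        ≤ M * |autocov X P d| ^ 3 := by
      rcases Nat.eq_zero_or_pos d with rfl | hd
      · rw [hX.autocov_zero, hY.autocov_zero, hM]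
        norm_num
        positivity
      · rw [hC d hd, abs_mul, mul_pow, ← sq_abs (autocov X P d), hM]
        have h3 : 0 ≤ |autocov X P d| ^ 3 := by positivity
        nlinarith
    calc _ ≤ 4 * (M * |autocov X P d| ^ 3) * F := by gcongr
      _ = _ := by ring
  have hbound : ∫ ω, ‖reductionError X Y P n ω p‖ ^ 2 ∂P
      ≤ 8 * M * ((1 / (n : ℝ)) * ∑ k ∈ Finset.range n, |autocov X P k| ^ 3) * F := by
    rw [he]
    calc _ ≤ (1 / (n : ℝ)) ^ 2 * ∑ j ∈ Finset.range n, ∑ k ∈ Finset.range n,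
            4 * M * F * |autocov X P (Nat.dist j k)| ^ 3 := by
          gcongr; exact hterm _
      _ = 4 * M * F * ((1 / (n : ℝ)) ^ 2 * ∑ j ∈ Finset.range n, ∑ k ∈ Finset.range n,
            |autocov X P (Nat.dist j k)| ^ 3) := by
          simp_rw [← Finset.mul_sum]; ring
      _ ≤ 4 * M * F * ((1 / (n : ℝ)) ^ 2 *
            (n * (2 * ∑ k ∈ Finset.range n, |autocov X P k| ^ 3))) := by
          gcongr
          exact sum_sum_dist_le (f := fun k => |autocov X P k| ^ 3) (fun k => by positivity) n
      _ = _ := by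
          rcases Nat.eq_zero_or_pos n with rfl | hn
          · simp
          · field_simp; ring
  calc ∫⁻ ω, ‖reductionError X Y P n ω p‖ₑ ^ 2 ∂P
      = ENNReal.ofReal (∫ ω, ‖reductionError X Y P n ω p‖ ^ 2 ∂P) := by
        rw [ofReal_integral_eq_lintegral_ofReal hi (Eventually.of_forall fun _ => by positivity)]
        refine lintegral_congr fun ω => ?_
        rw [ENNReal.ofReal_pow (norm_nonneg _), ofReal_norm]
    _ ≤ _ := by
        rw [← ENNReal.ofReal_mul (by positivity)]
        exact ENNReal.ofReal_le_ofReal hbound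

lemma MeasureTheory.eLpNorm_two_sq {α E : Type*} [MeasurableSpace α] [NormedAddCommGroup E]
    (f : α → E) (μ : Measure α) : eLpNorm f 2 μ ^ 2 = ∫⁻ x, ‖f x‖ₑ ^ 2 ∂μ := by
  have := eLpNorm_nnreal_pow_eq_lintegral (f := f) (μ := μ) (p := 2) two_ne_zero
  norm_num at this
  exact_mod_cast this

lemma lintegral_lpNorm_reductionError_sq_le [IsProbabilityMeasure P]
    (hX : IsStandardStationaryGaussian X P) (hY : IsStandardStationaryGaussian Y P)
    (hXY : IndepFun (fun ω k => X k ω) (fun ω k => Y k ω) P) {C : ℝ}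
    (hC : ∀ k : ℕ, 1 ≤ k → autocov Y P k = C * autocov X P k) {c : ℝ} (hc : 0 < c) (n : ℕ) :
    ∫⁻ ω, ENNReal.ofReal (lpNorm (reductionError X Y P n ω) 2 (dcovMeasure c)) ^ 2 ∂P ≤
      ENNReal.ofReal (8 * (|C| + C ^ 2 + 2) *
        ((1 / (n : ℝ)) * ∑ k ∈ Finset.range n, |autocov X P k| ^ 3)) *
      ∫⁻ p, ENNReal.ofReal (freqMajorant p.1 * freqMajorant p.2) ∂(dcovMeasure c) := by
  have : SFinite (dcovMeasure c) := by unfold dcovMeasure; infer_instance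
  simp_rw [ofReal_lpNorm (memLp_reductionError hX hY hc n _), eLpNorm_two_sq]
  rw [lintegral_lintegral_swap
    ((measurable_uncurry_reductionError hX hY n).enorm.pow_const 2).aemeasurable,
    ← lintegral_const_mul _ (by unfold freqMajorant; fun_prop)]
  exact lintegral_mono fun p => lintegral_enorm_sq_reductionError_le hX hY hXY hC n p

lemma measurable_lpNorm_reductionError (hX : IsStandardStationaryGaussian X P)
    (hY : IsStandardStationaryGaussian Y P) {c : ℝ} (hc : 0 < c) (n : ℕ) :
    Measurable fun ω => lpNorm (reductionError X Y P n ω) 2 (dcovMeasure c) := by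
  have : SFinite (dcovMeasure c) := by unfold dcovMeasure; infer_instance
  simp_rw [← toReal_eLpNorm (memLp_reductionError hX hY hc n _).aestronglyMeasurable,
    eLpNorm_eq_lintegral_rpow_enorm_toReal two_ne_zero ENNReal.ofNat_ne_top]
  exact (((measurable_uncurry_reductionError hX hY n).enorm.pow_const
    _).lintegral_prod_right'.pow_const _).ennreal_toReal

end TwoProcesses

theorem mainTheorem8 {Ω : Type*} [MeasurableSpace Ω] (P : Measure Ω) [IsProbabilityMeasure P]
    (X Y : ℕ → Ω → ℝ)
    (hX : IsStandardStationaryGaussian X P) (hY : IsStandardStationaryGaussian Y P)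
    (hXY : IndepFun (fun ω k => X k ω) (fun ω k => Y k ω) P)
    (D C : ℝ) (hD0 : 0 < D) (hD : D < 1 / 2)
    (L : ℝ → ℝ) (hL : IsSlowlyVarying L)
    (hρX : ∀ k : ℕ, 1 ≤ k → autocov X P k = (k : ℝ) ^ (-D) * L k)
    (hρY : ∀ k : ℕ, 1 ≤ k → autocov Y P k = C * (k : ℝ) ^ (-D) * L k)
    (c : ℝ) (hc : 0 < c) :
    (∀ n ω, MemLp (reductionError X Y P n ω) 2 (dcovMeasure c)) ∧
      IsLittleOInProbability P
        (fun n ω => lpNorm (reductionError X Y P n ω) 2 (dcovMeasure c))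
        (fun n => (n : ℝ) ^ (-D) * L n) := by
  refine ⟨memLp_reductionError hX hY hc, ?_⟩
  have hC : ∀ k : ℕ, 1 ≤ k → autocov Y P k = C * autocov X P k := fun k hk => by
    rw [hρX k hk, hρY k hk]; ring
  set a : ℕ → ℝ := fun n => (n : ℝ) ^ (-D) * L n with ha
  set I := ∫⁻ p : ℝ × ℝ, ENNReal.ofReal (freqMajorant p.1 * freqMajorant p.2) ∂(dcovMeasure c)
  have hI : I ≠ ⊤ := (lintegral_freqMajorant_mul_lt_top hc).ne
  set B := 8 * (|C| + C ^ 2 + 2)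
  refine tendstoInMeasure_of_tendsto_eLpNorm (p := 2) two_ne_zero
    (fun n => ((measurable_lpNorm_reductionError hX hY hc n).div_const _).aestronglyMeasurable)
    aestronglyMeasurable_const ?_
  have hsq : Tendsto (fun n => eLpNorm ((fun ω => lpNorm (reductionError X Y P n ω) 2
      (dcovMeasure c) / a n) - fun _ => 0) 2 P ^ 2) atTop (𝓝 0) := by
    have hlim : Tendsto (fun n : ℕ => ENNReal.ofReal (B * (((1 / (n : ℝ)) *
        ∑ k ∈ Finset.range n, |autocov X P k| ^ 3) / a n ^ 2)) * I) atTop (𝓝 0) := by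
      have h := (hL.tendsto_mean_abs_cube_div_sq hD0 hD hρX).const_mul B
      rw [mul_zero] at h
      simpa using ENNReal.Tendsto.mul_const (ENNReal.tendsto_ofReal h) (Or.inr hI)
    refine tendsto_of_tendsto_of_tendsto_of_le_of_le tendsto_const_nhds hlim
      (fun n => zero_le) fun n => ?_
    simp only [eLpNorm_two_sq, Pi.sub_apply, sub_zero]
    have e : ∀ ω, ‖lpNorm (reductionError X Y P n ω) 2 (dcovMeasure c) / a n‖ₑ ^ 2
        = ENNReal.ofReal ((a n ^ 2)⁻¹) *
          ENNReal.ofReal (lpNorm (reductionError X Y P n ω) 2 (dcovMeasure c)) ^ 2 := fun ω => by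
      rw [← ofReal_norm, ← ENNReal.ofReal_pow (norm_nonneg _), ← ENNReal.ofReal_pow lpNorm_nonneg,
        ← ENNReal.ofReal_mul (by positivity), Real.norm_eq_abs, sq_abs]
      congr 1; ring
    simp_rw [e]
    rw [lintegral_const_mul _
      ((measurable_lpNorm_reductionError hX hY hc n).ennreal_ofReal.pow_const 2)]
    calc _ ≤ ENNReal.ofReal ((a n ^ 2)⁻¹) * (ENNReal.ofReal (B * ((1 / (n : ℝ)) *
            ∑ k ∈ Finset.range n, |autocov X P k| ^ 3)) * I) := by
          gcongr
          exact lintegral_lpNorm_reductionError_sq_le hX hY hXY hC hc n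
      _ = _ := by
          rw [← mul_assoc, ← ENNReal.ofReal_mul (by positivity)]
          congr 2; ring
  have := (ENNReal.continuous_rpow_const (y := 1 / 2)).tendsto 0 |>.comp hsq
  rw [ENNReal.zero_rpow_of_pos (by norm_num)] at this
  refine this.congr fun n => ?_
  simp only [Function.comp]
  rw [← ENNReal.rpow_natCast, ← ENNReal.rpow_mul]
  norm_num
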